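/- Let $F$ be a field of characteristic $0$, let $H$ be a finite-dimensional associative $F$-algebra with $1$, and let $L$ be a finite-dimensional semisimple Lie algebra over $F$ with a generalized action of $H$, i.e. a unital homomorphism $\rho\colon H\to\operatorname{End}_F(L)$, written $\rho(h)a=ha$, such that for every $h\in H$ there are finitely many $h'_i,h''_i\in H$ with $h[a,b]=\sum_i[h'_ia,h''_ib]$ for all $a,b\in L$. Assume that $L$ is $H$-simple, i.e. $L$ is non-abelian and its only $H$-invariant ideals are $0$ and $L$. Assume moreover that $F$ is algebraically closed or, more generally, that the only $F$-linear maps $L\to L$ commuting with $\rho(H)$ and with $\operatorname{ad}(L)$ are the scalars. Let $l_1,\dots,l_t$ be a basis of $L$, $t=\dim_F L$. For a set $X$ of variables let $L(X\mid H)$ be the free Lie algebra on the symbols $x^{\gamma}$, where $x\in X$ and $\gamma$ runs over a basis of $H$; for $h=\sum_\gamma c_\gamma\gamma\in H$ put $x^h=\sum_\gamma c_\gamma x^{\gamma}$. Its elements are called $H$-polynomials; they are evaluated on $L$ by $x\mapsto a_x$, $x^h\mapsto ha_x$. An $H$-polynomial in $x_1,\dots,x_n$ is multilinear if it is a linear combination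 of left-normed commutators $[x_{\sigma(1)}^{h_1},\dots,x_{\sigma(n)}^{h_n}]$ with $\sigma\in S_n$ and $h_1,\dots,h_n\in H$; it is alternating in a set of variables if every permutation of that set multiplies it by the sign of the permutation. Then there exist an integer $C>0$ and elements $\bar z_1,\dots,\bar z_C\in L$ such that for every $k\ge 0$ there is a multilinear $H$-polynomial $$f=f(x_1^1,\dots,x_t^1;\ \dots;\ x_1^{2k},\dots,x_t^{2k};\ z_1,\dots,z_C;\ z)$$ in these $2kt+C+1$ variables that is alternating in each of the $2k$ sets $\{x_1^j,\dots,x_t^j\}$, $1\le j\le 2k$, and satisfies $$f(l_1,\dots,l_t;\ \dots;\ l_1,\dots,l_t;\ \bar z_1,\dots,\bar z_C;\ \bar z)=\bar z\qquad\text{for every }\bar z\in L.$$ -/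

import Mathlib

noncomputable section

namespace HLie

/-- A generalized action of the unital associative algebra `H` on the Lie algebra `L`: a unital
algebra homomorphism `ρ : H → End_F(L)` such that for every `h` there are `h'ᵢ, h''ᵢ ∈ H` with
`h⁅a, b⁆ = ∑ᵢ ⁅h'ᵢ a, h''ᵢ b⁆` for all `a, b ∈ L`. -/
def IsGeneralizedAction {F H L : Type*} [Field F] [Ring H] [Algebra F H] [LieRing L]
    [LieAlgebra F L] (ρ : H →ₐ[F] Module.End F L) : Prop :=
  ∀ h : H, ∃ (n : ℕ) (h' h'' : Fin n → H), ∀ a b : L,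
    ρ h ⁅a, b⁆ = ∑ i, ⁅ρ (h' i) a, ρ (h'' i) b⁆

/-- `L` is `H`-simple: it is non-abelian and its only `H`-invariant ideals are `0` and `L`. -/
def IsHSimple {F H L : Type*} [Field F] [Ring H] [Algebra F H] [LieRing L]
    [LieAlgebra F L] (ρ : H →ₐ[F] Module.End F L) : Prop :=
  ¬ IsLieAbelian L ∧
    ∀ I : LieIdeal F L, (∀ h : H, ∀ a ∈ I, ρ h a ∈ I) → I = ⊥ ∨ I = ⊤

/-- `L` is `H`-central: the `F`-linear maps `L → L` that commute with the adjoint action and with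
the action of `H` are the scalars. -/
def IsHCentral {F H L : Type*} [Field F] [Ring H] [Algebra F H] [LieRing L]
    [LieAlgebra F L] (ρ : H →ₐ[F] Module.End F L) : Prop :=
  ∀ φ : Module.End F L, (∀ a : L, Commute φ (LieAlgebra.ad F L a)) →
    (∀ h : H, Commute φ (ρ h)) → ∃ c : F, φ = c • (1 : Module.End F L)

/-- Index set of a fixed `F`-basis of `H`. -/
abbrev BasisIndex (F H : Type*) [Field F] [Ring H] [Algebra F H] : Type _ :=
  Module.Basis.ofVectorSpaceIndex F H

/-- The algebra `L(X | H)` of Lie `H`-polynomials in the variables `X`: the free Lie algebra on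
the symbols `x^γ`, where `x ∈ X` and `γ` runs over a fixed basis of `H`. -/
abbrev HPoly (F H X : Type*) [Field F] [Ring H] [Algebra F H] : Type _ :=
  FreeLieAlgebra F (X × BasisIndex F H)

/-- The element `x^h` of `L(X | H)`, linear in `h ∈ H`. -/
def HPoly.var (F : Type*) {H X : Type*} [Field F] [Ring H] [Algebra F H] (x : X) (h : H) :
    HPoly F H X :=
  ((Module.Basis.ofVectorSpace F H).repr h).sum fun γ c => c • FreeLieAlgebra.of F (x, γ)

/-- The value of an `H`-polynomial under the substitution `x ↦ a x`, that is, `x^h ↦ h (a x)`. -/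
def HPoly.eval {F H L X : Type*} [Field F] [Ring H] [Algebra F H] [LieRing L]
    [LieAlgebra F L] (ρ : H →ₐ[F] Module.End F L) (a : X → L) : HPoly F H X →ₗ⁅F⁆ L :=
  FreeLieAlgebra.lift F fun p => ρ (Module.Basis.ofVectorSpace F H p.2) (a p.1)

/-- Renaming of variables: `x^h ↦ (s x)^h`. -/
def HPoly.rename {F H X Y : Type*} [Field F] [Ring H] [Algebra F H] (s : X → Y) :
    HPoly F H X →ₗ⁅F⁆ HPoly F H Y :=
  FreeLieAlgebra.lift F fun p => FreeLieAlgebra.of F (s p.1, p.2)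

/-- The left-normed commutator `[a₁, …, aₙ] = [[a₁, …, aₙ₋₁], aₙ]`. -/
def leftNormed {M : Type*} [LieRing M] : List M → M
  | [] => 0
  | a :: l => l.foldl (fun u v => ⁅u, v⁆) a

/-- The space `V_n^H` of multilinear `H`-polynomials in the variables of the finite set `X`
(`n = |X|`): the span of all `[x_{σ(1)}^{h₁}, …, x_{σ(n)}^{hₙ}]`. -/
def HPoly.multilinear (F H X : Type*) [Field F] [Ring H] [Algebra F H] [Fintype X] :
    Submodule F (HPoly F H X) :=
  Submodule.span F {f | ∃ (e : Fin (Fintype.card X) ≃ X) (h : Fin (Fintype.card X) → H),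
    f = leftNormed (List.ofFn fun i => HPoly.var F (e i) (h i))}

/-- `f` is alternating in the set `S` of variables: every permutation `σ` of the variables in `S`
multiplies `f` by its sign. -/
def HPoly.IsAlternatingIn {F H X : Type*} [Field F] [Ring H] [Algebra F H] [Fintype X]
    [DecidableEq X] (f : HPoly F H X) (S : Set X) : Prop :=
  ∀ σ : Equiv.Perm X, (∀ x, x ∉ S → σ x = x) →
    HPoly.rename σ f = ((Equiv.Perm.sign σ : ℤ) : F) • f

/-- The variables `x_i^j` (`i < t`, `j < m`), `z_1, …, z_C` and `z`. -/
abbrev Var (t m C : ℕ) : Type := (Fin m × Fin t) ⊕ (Fin C ⊕ Unit)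

/-- The `j`-th set of variables `{x_1^j, …, x_t^j}`. -/
def Var.block {t m C : ℕ} (j : Fin m) : Set (Var t m C) :=
  Set.range fun i : Fin t => Sum.inl (j, i)

/-- The substitution `x_i^j ↦ l_i`, `z_i ↦ w_i`, `z ↦ v`. -/
def Var.subst {L : Type*} {t m C : ℕ} (l : Fin t → L) (w : Fin C → L) (v : L) :
    Var t m C → L :=
  Sum.elim (fun p => l p.2) (Sum.elim w fun _ => v)

end HLie

end

/-! The polynomial is built as an operator that acts on `z` as a scalar. By the density theorem, `ad
L` and `ρ(H)` generate `End L` (`adjoin_eq_top`), so the operators `ad l_i` extend to a basis of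
`End L` by values of products of operators `ρ h` and `ad (h a)`. Razmyslov's central polynomial
takes only scalar values, `tr W` times the trace of the Capelli polynomial (`centralPoly_eq`). With
`ad z_1, …, ad z_t` in `t` of its alternating slots, the scalar is a top-degree alternating form in
the `z_i`, hence `det(z) θ` with `θ` free of the `z_i` (`exists_realizable_det_smul_one`).

Replacing `z_i` by `[u,[v,z_i]]` and summing over `i` multiplies this form by `tr(ad u ad v)`, the
Killing form (`killing_smul`). Iterating and antisymmetrizing gives the factor `det κ(u_i,v_j)`, a
nonzero constant times `det(u) det(v)`: two new alternating sets, at no cost in auxiliary variables.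
Hence `C` does not depend on `k`.

Finally such operators are turned into multilinear `H`-polynomials in one more variable
(`exists_multilinear`), and averaging over permutations makes the polynomials themselves alternating
(`exists_alternating`). -/

namespace HLie

open Module

/-! ### Trace identities and Razmyslov's central polynomial. -/

section LinearAlgebra

variable {F : Type*} [Field F]

/-- The derivation induced by `φ` acts on alternating forms of top degree by the trace of `φ`. -/
theorem sum_alternating_update {V ι : Type*} [AddCommGroup V] [Module F V] [Fintype ι]
    [DecidableEq ι] (b : Basis ι F V) (d : V [⋀^ι]→ₗ[F] F) (φ : End F V) (v : ι → V) :
    ∑ i, d (Function.update v i (φ (v i))) = LinearMap.trace F V φ * d v := by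
  let g : ι → ι → End F V := fun i j => if j = i then φ else LinearMap.id
  have hg : ∀ (i : ι) (v : ι → V),
      (fun j => g i j (v j)) = Function.update v i (φ (v i)) := by
    intro i v
    ext j
    by_cases h : j = i
    · subst h; simp [g]
    · simp [g, h]
  -- If two arguments coincide, only the terms updating one of them survive, and these differ by a
  -- transposition. As a top-degree form, `S` is then determined by its value on `b`.
  let S : V [⋀^ι]→ₗ[F] F :=
    { (∑ i, d.toMultilinearMap.compLinearMap (g i)) with
      map_eq_zero_of_eq' := by
        intro v p q hpq hne
        simp only [MultilinearMap.toFun_eq_coe, _root_.sum_apply,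
          MultilinearMap.compLinearMap_apply, hg, AlternatingMap.coe_multilinearMap]
        rw [Fintype.sum_eq_add p q hne]
        · have : Function.update v q (φ (v q)) =
              Function.update v p (φ (v p)) ∘ Equiv.swap p q := by
            ext j
            by_cases h1 : j = p
            · subst h1
              simp [hne, Function.update_of_ne hne.symm, hpq]
            · by_cases h2 : j = q
              · subst h2; simp [hpq]
              · simp [Equiv.swap_apply_of_ne_of_ne h1 h2, h1, h2]
          rw [this, d.map_swap _ hne, add_neg_cancel]
        · rintro x ⟨hxp, hxq⟩
          apply d.map_eq_zero_of_eq _ _ hne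
          simp [Function.update_of_ne hxp.symm, Function.update_of_ne hxq.symm, hpq] }
  have hS : ∀ v, S v = ∑ i, d (Function.update v i (φ (v i))) := by
    intro v
    change (∑ i, d.toMultilinearMap.compLinearMap (g i)) v = _
    simp only [_root_.sum_apply,
          MultilinearMap.compLinearMap_apply, hg, AlternatingMap.coe_multilinearMap]
  have hb : S b = LinearMap.trace F V φ * d b := by
    rw [hS, LinearMap.trace_eq_matrix_trace F b, Matrix.trace, Finset.sum_mul]
    refine Finset.sum_congr rfl fun i _ => ?_
    conv_lhs => rw [← b.sum_repr (φ (b i))]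
    rw [d.map_update_sum, Finset.sum_eq_single i]
    · simp [LinearMap.toMatrix_apply]
    · intro j _ hji
      rw [d.map_update_smul, d.map_update_self _ hji.symm, smul_zero]
    · simp
  rw [← hS, S.eq_smul_basis_det b, AlternatingMap.smul_apply, hb]
  conv_rhs => rw [d.eq_smul_basis_det b]
  simp [mul_assoc]

variable {V : Type*} [AddCommGroup V] [Module F V]

/-- On the matrix unit `E_ij`, the map `M ↦ Z M W` has diagonal coefficient `Z_ii W_jj`. -/
theorem trace_mulLeft_mulRight [FiniteDimensional F V] (Z W : End F V) :
    LinearMap.trace F (End F V) (LinearMap.mulLeft F Z ∘ₗ LinearMap.mulRight F W) =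
      LinearMap.trace F V Z * LinearMap.trace F V W := by
  let b := Module.finBasis F V
  rw [LinearMap.trace_eq_matrix_trace F (b.linearMap b), LinearMap.trace_eq_matrix_trace F b Z,
    LinearMap.trace_eq_matrix_trace F b W, Matrix.trace, Matrix.trace, Matrix.trace,
    Finset.sum_mul_sum, Fintype.sum_prod_type]
  refine Finset.sum_congr rfl fun i _ => Finset.sum_congr rfl fun j _ => ?_
  have h : LinearMap.toMatrix b b (b.linearMap b (i, j)) = Matrix.single i j 1 := by
    rw [Basis.linearMap_apply, LinearMap.toMatrix_toLin, Matrix.stdBasis_eq_single]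
  have h2 : ∀ M N : Matrix (Fin (finrank F V)) (Fin (finrank F V)) F,
      (M * (Matrix.single i j (1 : F) * N) : Matrix _ _ F) i j = M i i * N j j := by
    intro M N
    rw [Matrix.mul_apply, Finset.sum_eq_single i]
    · simp
    · intro k _ hk
      simp [hk]
    · simp
  have h3 := h2 (LinearMap.toMatrix b b Z) (LinearMap.toMatrix b b W)
  rw [← h, ← LinearMap.toMatrix_mul, ← LinearMap.toMatrix_mul] at h3
  rw [Matrix.diag_apply, LinearMap.toMatrix_apply, Basis.linearMap_repr_apply]
  exact h3

theorem eq_of_trace_mul_eq [FiniteDimensional F V] {A B : End F V}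
    (h : ∀ Z, LinearMap.trace F V (Z * A) = LinearMap.trace F V (Z * B)) : A = B := by
  let b := Module.finBasis F V
  refine b.ext fun i => b.ext_elem fun j => ?_
  have := h ((b.coord j).smulRight (b i))
  have hh : ∀ C : End F V, (b.coord j).smulRight (b i) * C = (b.coord j ∘ₗ C).smulRight (b i) := by
    intro C; ext v; simp
  rw [hh, hh, LinearMap.trace_smulRight, LinearMap.trace_smulRight] at this
  simpa using this

/-- The product `X₀ Y₀ X₁ Y₁ ⋯`, as a multilinear map in `X`. -/
noncomputable def capelliWord {A : Type*} [Ring A] [Algebra F A] {n : ℕ} (Y : Fin n → A) :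
    MultilinearMap F (fun _ : Fin n => A) A :=
  (MultilinearMap.mkPiAlgebraFin F n A).compLinearMap fun p => LinearMap.mulRight F (Y p)

/-- The trace of the Capelli polynomial, as an alternating form in `X`. -/
noncomputable def capelliForm {n : ℕ} (Y : Fin n → End F V) : (End F V) [⋀^Fin n]→ₗ[F] F :=
  MultilinearMap.alternatization ((LinearMap.trace F V).compMultilinearMap (capelliWord Y))

theorem capelliForm_apply {n : ℕ} (X Y : Fin n → End F V) :
    capelliForm Y X = ∑ σ : Equiv.Perm (Fin n), Equiv.Perm.sign σ •
      LinearMap.trace F V (List.ofFn fun p => X (σ p) * Y p).prod := by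
  simp [capelliForm, MultilinearMap.alternatization_apply, capelliWord]

/-- The product `X_p W Y_p ⋯ X_{n-1} Y_{n-1} X₀ Y₀ ⋯ X_{p-1} Y_{p-1}`. -/
noncomputable def rotatedWord {A : Type*} [Monoid A] {n : ℕ} (X Y : Fin n → A) (W : A)
    (p : Fin n) : A :=
  X p * W * Y p * (((List.finRange n).drop (p + 1)).map fun q => X q * Y q).prod *
    (((List.finRange n).take p).map fun q => X q * Y q).prod

/-- Razmyslov's central polynomial. -/
noncomputable def centralPoly {A : Type*} [Ring A] {n : ℕ} (X Y : Fin n → A) (W : A) : A :=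
  ∑ σ : Equiv.Perm (Fin n), Equiv.Perm.sign σ • ∑ p, rotatedWord (X ∘ σ) Y W p

/-- Cyclicity of the trace: this is why the word is rotated to begin inside its `p`-th factor. -/
theorem trace_mul_rotatedWord {n : ℕ} (X Y : Fin n → End F V) (W Z : End F V) (p : Fin n) :
    LinearMap.trace F V (Z * rotatedWord X Y W p) =
      LinearMap.trace F V
        (List.ofFn fun q => Function.update X p (Z * (X p * W)) q * Y q).prod := by
  have h : (List.ofFn fun q => Function.update X p (Z * (X p * W)) q * Y q) =
      ((List.finRange n).map fun q => X q * Y q).set p (Z * (X p * W) * Y p) := by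
    apply List.ext_getElem
    · simp
    · intro i h1 h2
      simp only [List.getElem_ofFn, List.getElem_set, List.getElem_map, List.getElem_finRange]
      by_cases hi : (p : ℕ) = i
      · subst hi; simp
      · have : (⟨i, by simpa using h1⟩ : Fin n) ≠ p := fun h => hi (by rw [← h])
        simp [hi, this]
  rw [h, List.prod_set, rotatedWord, List.map_drop, List.map_take]
  simp only [List.length_map, List.length_finRange, p.isLt, if_true]
  rw [← mul_assoc, LinearMap.trace_mul_comm]
  simp only [mul_assoc]

/-- Pairing with `Z` under the trace turns the sum over `p` into the derivation induced by `M ↦ Z M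
W` on a form of top degree on `End V`. It acts by its trace `tr Z · tr W`, and nondegeneracy of the
trace form removes `Z`. -/
theorem centralPoly_eq [FiniteDimensional F V] {n : ℕ} (hn : finrank F (End F V) = n)
    (X Y : Fin n → End F V) (W : End F V) :
    centralPoly X Y W = (LinearMap.trace F V W * capelliForm Y X) • 1 := by
  refine eq_of_trace_mul_eq fun Z => ?_
  have key := sum_alternating_update (Module.finBasisOfFinrankEq F (End F V) hn)
    (capelliForm Y) (LinearMap.mulLeft F Z ∘ₗ LinearMap.mulRight F W) X
  rw [trace_mulLeft_mulRight] at key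
  rw [mul_smul_comm, mul_one, map_smul, smul_eq_mul]
  rw [show LinearMap.trace F V W * capelliForm Y X * LinearMap.trace F V Z =
    LinearMap.trace F V Z * LinearMap.trace F V W * capelliForm Y X by ring, ← key]
  simp only [capelliForm_apply, centralPoly, Finset.mul_sum, map_sum, mul_smul_comm]
  rw [Finset.sum_comm]
  refine Finset.sum_congr rfl fun σ _ => ?_
  rw [← Finset.smul_sum, Units.smul_def, Units.smul_def, map_zsmul, map_sum]
  congr 1
  conv_rhs => rw [← Equiv.sum_comp σ]
  refine Finset.sum_congr rfl fun p _ => ?_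
  rw [trace_mul_rotatedWord]
  congr 3
  ext1 q
  by_cases h : q = p
  · subst h; simp
  · simp [h]

theorem prod_ofFn_smulRight {n : ℕ} (x : Fin (n + 1) → V) (μ : Fin (n + 1) → Dual F V) :
    (List.ofFn fun p => ((μ p).smulRight (x p) : End F V)).prod =
      (∏ p : Fin n, μ p.castSucc (x p.succ)) • (μ (Fin.last n)).smulRight (x 0) := by
  induction n with
  | zero => simp
  | succ n ih =>
    rw [List.ofFn_succ, List.prod_cons, ih (fun p => x p.succ) (fun p => μ p.succ),
      Fin.prod_univ_succ]
    ext v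
    simp [smul_smul, mul_comm, mul_assoc]

/-- The addition `p + 1` in `Fin (n + 1)` is cyclic: the last functional is `ν 0`, which closes the
trace of the rank-one product. -/
theorem capelliForm_smulRight [FiniteDimensional F V] {n : ℕ} (ν : Fin (n + 1) → Dual F V)
    (u : Fin (n + 1) → V) (X : Fin (n + 1) → End F V) :
    capelliForm (fun p => (ν (p + 1)).smulRight (u p)) X =
      (Matrix.of fun q p => ν p (X q (u p))).det := by
  rw [capelliForm_apply, Matrix.det_apply]
  refine Finset.sum_congr rfl fun σ _ => ?_
  congr 1
  have : ∀ p, X (σ p) * (ν (p + 1)).smulRight (u p) =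
      (ν (p + 1)).smulRight (X (σ p) (u p)) := by
    intro p; ext v; simp
  simp only [this]
  rw [prod_ofFn_smulRight, map_smul, LinearMap.trace_smulRight, Fin.prod_univ_succ]
  simp [mul_comm]

theorem exists_capelliForm_ne_zero [FiniteDimensional F V] [Nontrivial V] {n : ℕ}
    (X : Basis (Fin n) F (End F V)) :
    ∃ p : Fin n → Fin n, capelliForm (fun i => X (p i)) X ≠ 0 := by
  have hn : n ≠ 0 := by
    rintro rfl
    have := X.index_nonempty
    exact IsEmpty.false this.some
  obtain ⟨n, rfl⟩ := Nat.exists_eq_succ_of_ne_zero hn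
  let b := Module.finBasis F V
  let e : Fin (n + 1) ≃ Fin (finrank F V) × Fin (finrank F V) := by
    refine Fintype.equivOfCardEq ?_
    have := Module.finrank_eq_card_basis X
    rw [Module.finrank_linearMap] at this
    simpa using this.symm
  have h1 : ∃ Y, capelliForm Y X ≠ 0 := by
    refine ⟨fun p => (b.coord (e (p + 1)).1).smulRight (b (e p).2), ?_⟩
    -- A top-degree form that is nonzero anywhere is nonzero on a basis, so matrix units may be
    -- tested instead of `X`; they give the identity matrix.
    rw [AlternatingMap.map_basis_ne_zero_iff]
    intro h0
    have h2 := capelliForm_smulRight (fun p => b.coord (e p).1) (fun p => b (e p).2)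
      (fun p => (b.coord (e p).2).smulRight (b (e p).1))
    have h3 : (Matrix.of fun q p => b.coord (e p).1
        ((b.coord (e q).2).smulRight (b (e q).1) (b (e p).2))) = (1 : Matrix _ _ F) := by
      ext q p
      by_cases h : q = p
      · subst h; simp
      · have h' : e q ≠ e p := fun hh => h (e.injective hh)
        rw [Matrix.one_apply_ne h]
        simp only [Matrix.of_apply, LinearMap.smulRight_apply, Basis.coord_apply, Basis.repr_self,
          map_smul, Finsupp.single_apply, smul_eq_mul]
        by_cases h4 : (e p).2 = (e q).2
        · have : (e q).1 ≠ (e p).1 := fun h5 => h' (Prod.ext h5 h4.symm)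
          simp [this]
        · simp [h4]
    rw [h3, h0] at h2
    simp at h2
  by_contra! hcon
  obtain ⟨Y, hY⟩ := h1
  -- Multilinearity in `Y` allows each `Y p` to be chosen among the basis vectors.
  let G : MultilinearMap F (fun _ : Fin (n + 1) => End F V) F :=
    ∑ σ : Equiv.Perm (Fin (n + 1)), Equiv.Perm.sign σ •
      (LinearMap.trace F V).compMultilinearMap
        ((MultilinearMap.mkPiAlgebraFin F (n + 1) (End F V)).compLinearMap
          fun p => LinearMap.mulLeft F (X (σ p)))
  have hG : ∀ Y, G Y = capelliForm Y X := by
    intro Y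
    rw [capelliForm_apply]
    simp [G]
  have : G = 0 := Basis.ext_multilinear (fun _ => X) fun p => by
    rw [hG]; simpa using hcon p
  exact hY (by rw [← hG, this]; rfl)

end LinearAlgebra

/-! ### Operator-valued functions built from `ad` and `ρ`, and their normal form. -/

section Realizable

variable {F H L : Type*} [Field F] [Ring H] [Algebra F H] [LieRing L] [LieAlgebra F L]

/-- `Realizable ρ m f`: the operator-valued function `f` of the variables `ι` is a linear
combination of products of operators `ρ h` and `ad (h aᵢ)` in which every variable `i` occurs
exactly as often as it does in the multiset `m`. -/
inductive Realizable {ι : Type*} (ρ : H →ₐ[F] End F L) :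
    Multiset ι → ((ι → L) → End F L) → Prop
  | zero (m) : Realizable ρ m 0
  | add {m f g} : Realizable ρ m f → Realizable ρ m g → Realizable ρ m (f + g)
  | smul {m f} (c : F) : Realizable ρ m f → Realizable ρ m (c • f)
  | mul {m m' f g} : Realizable ρ m f → Realizable ρ m' g → Realizable ρ (m + m') (f * g)
  | act (h : H) : Realizable ρ 0 fun _ => ρ h
  | ad (h : H) (i : ι) : Realizable ρ {i} fun a => LieAlgebra.ad F L (ρ h (a i))

namespace Realizable

variable {ι κ : Type*} {ρ : H →ₐ[F] End F L} {m m' : Multiset ι} {f g : (ι → L) → End F L}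

theorem congr (hf : Realizable ρ m f) (hm : m = m') (hfg : ∀ a, f a = g a) :
    Realizable ρ m' g := by
  obtain rfl := funext hfg
  exact hm ▸ hf

theorem one : Realizable ρ (0 : Multiset ι) fun _ => 1 :=
  (act 1).congr rfl fun _ => map_one ρ

theorem sub (hf : Realizable ρ m f) (hg : Realizable ρ m g) : Realizable ρ m (f - g) :=
  (hf.add (hg.smul (-1))).congr rfl fun a => by simp [sub_eq_add_neg]

theorem sum {α : Type*} (s : Finset α) {f : α → (ι → L) → End F L}
    (hf : ∀ i ∈ s, Realizable ρ m (f i)) : Realizable ρ m fun a => ∑ i ∈ s, f i a := by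
  classical
  induction s using Finset.induction_on with
  | empty => exact (zero m).congr rfl fun a => by simp
  | insert x s hx ih =>
    refine ((hf x (by simp)).add (ih fun i hi => hf i (by simp [hi]))).congr rfl fun a => ?_
    simp [Finset.sum_insert hx]

theorem zsmul (c : ℤ) (hf : Realizable ρ m f) : Realizable ρ m fun a => c • f a :=
  (hf.smul (c : F)).congr rfl fun a => by simp [Int.cast_smul_eq_zsmul]

theorem list_prod {α : Type*} (s : List α) {N : α → Multiset ι} {f : α → (ι → L) → End F L}
    (hf : ∀ i, Realizable ρ (N i) (f i)) :
    Realizable ρ (s.map N).sum fun a => (s.map fun i => f i a).prod := by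
  induction s with
  | nil => exact one.congr (by simp) (by simp)
  | cons x s ih => exact ((hf x).mul ih).congr (by simp) (by simp)

/-- Substitution of Lie-algebra-valued functions for the variables. -/
theorem bind {N : ι → Multiset κ} {b : ι → (κ → L) → L}
    (hb : ∀ i h, Realizable ρ (N i) fun a => LieAlgebra.ad F L (ρ h (b i a)))
    (hf : Realizable ρ m f) : Realizable ρ (m.bind N) fun a => f fun i => b i a := by
  induction hf with
  | zero m => exact (zero _).congr rfl (by simp)
  | add _ _ h1 h2 => exact h1.add h2
  | smul c _ h => exact h.smul c
  | mul _ _ h1 h2 => exact (h1.mul h2).congr (by simp) fun a => rfl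
  | act h => exact act h
  | ad h i => exact (hb i h).congr (by simp) fun a => rfl

theorem rename (e : ι → κ) (hf : Realizable ρ m f) :
    Realizable ρ (m.map e) fun a => f (a ∘ e) :=
  (hf.bind (N := fun i => {e i}) (b := fun i a => a (e i)) fun i h => ad h (e i)).congr
    (by simp) fun a => rfl

/-- `ad (h[x,y])` is a sum of commutators of `ad (h'x)` and `ad (h''y)`. -/
theorem ad_lie (hρ : IsGeneralizedAction ρ) {x y : (ι → L) → L}
    (hx : ∀ h, Realizable ρ m fun a => LieAlgebra.ad F L (ρ h (x a)))
    (hy : ∀ h, Realizable ρ m' fun a => LieAlgebra.ad F L (ρ h (y a))) (h : H) :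
    Realizable ρ (m + m') fun a => LieAlgebra.ad F L (ρ h ⁅x a, y a⁆) := by
  obtain ⟨n, h', h'', hh⟩ := hρ h
  refine (sum (Finset.univ : Finset (Fin n)) fun i _ =>
    ((hx (h' i)).mul (hy (h'' i))).sub
      (((hy (h'' i)).mul (hx (h' i))).congr (add_comm _ _) fun a => rfl)).congr rfl fun a => ?_
  rw [hh, map_sum]
  refine Finset.sum_congr rfl fun i _ => ?_
  ext v
  simp

end Realizable

/-- The operator `ad (h₁ a_{i₁}) ⋯ ad (hₙ a_{iₙ}) h₀`. -/
def adWord {ι : Type*} (ρ : H →ₐ[F] End F L) (s : List (ι × H)) (h₀ : H) (a : ι → L) : End F L :=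
  (s.map fun p => LieAlgebra.ad F L (ρ p.2 (a p.1))).prod * ρ h₀

/-- The span of the operators `adWord ρ s h₀`, where the variables in `s` form the multiset `m`. -/
def adWordSpan {ι : Type*} (ρ : H →ₐ[F] End F L) (m : Multiset ι) :
    Submodule F ((ι → L) → End F L) :=
  Submodule.span F {f | ∃ s h₀, (s.map Prod.fst : Multiset ι) = m ∧ f = adWord ρ s h₀}

section

variable {ι : Type*} {ρ : H →ₐ[F] End F L} {m m' : Multiset ι} {f g : (ι → L) → End F L}

theorem ad_mul_mem (h : H) (i : ι) (hf : f ∈ adWordSpan ρ m) :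
    (fun a => LieAlgebra.ad F L (ρ h (a i))) * f ∈ adWordSpan ρ (i ::ₘ m) := by
  induction hf using Submodule.span_induction with
  | mem f hf =>
    obtain ⟨s, h₀, rfl, rfl⟩ := hf
    refine Submodule.subset_span ⟨(i, h) :: s, h₀, by simp, ?_⟩
    ext1 a
    simp [adWord, mul_assoc]
  | zero => simp
  | add f g _ _ h1 h2 => rw [mul_add]; exact add_mem h1 h2
  | smul c f _ h1 => rw [mul_smul_comm]; exact Submodule.smul_mem _ _ h1

/-- The rule `ρ(h) ad(x) = ∑ ad(h'x) ρ(h'')` moves `ρ(h)` to the right end of the word. -/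
theorem act_mul_adWord_mem (hρ : IsGeneralizedAction ρ) (h : H) (s : List (ι × H)) (h₀ : H) :
    (fun _ => ρ h) * adWord ρ s h₀ ∈ adWordSpan ρ (s.map Prod.fst : Multiset ι) := by
  induction s generalizing h with
  | nil =>
    refine Submodule.subset_span ⟨[], h * h₀, rfl, ?_⟩
    ext1 a
    simp [adWord]
  | cons p s ih =>
    obtain ⟨n, h', h'', hh⟩ := hρ h
    have : (fun _ => ρ h) * adWord ρ (p :: s) h₀ =
        ∑ k, (fun a => LieAlgebra.ad F L (ρ (h' k * p.2) (a p.1))) *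
          ((fun _ => ρ (h'' k)) * adWord ρ s h₀) := by
      ext a v
      simp [adWord, hh]
    rw [this, List.map_cons, ← Multiset.cons_coe]
    refine Submodule.sum_mem _ fun k _ => ?_
    exact ad_mul_mem (h' k * p.2) p.1 (ih (h'' k))

theorem act_mul_mem (hρ : IsGeneralizedAction ρ) (h : H) (hf : f ∈ adWordSpan ρ m) :
    (fun _ => ρ h) * f ∈ adWordSpan ρ m := by
  induction hf using Submodule.span_induction with
  | mem f hf =>
    obtain ⟨s, h₀, rfl, rfl⟩ := hf
    exact act_mul_adWord_mem hρ h s h₀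
  | zero => simp
  | add f g _ _ h1 h2 => rw [mul_add]; exact add_mem h1 h2
  | smul c f _ h1 => rw [mul_smul_comm]; exact Submodule.smul_mem _ _ h1

theorem mul_mem_adWordSpan (hρ : IsGeneralizedAction ρ) (hf : f ∈ adWordSpan ρ m)
    (hg : g ∈ adWordSpan ρ m') : f * g ∈ adWordSpan ρ (m + m') := by
  induction hf using Submodule.span_induction with
  | mem f hf =>
    obtain ⟨s, h₀, rfl, rfl⟩ := hf
    induction s with
    | nil =>
      have : adWord ρ ([] : List (ι × H)) h₀ = fun _ => ρ h₀ := by ext1; simp [adWord]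
      simpa [this] using act_mul_mem hρ h₀ hg
    | cons p s ih =>
      have : adWord ρ (p :: s) h₀ * g =
          (fun a => LieAlgebra.ad F L (ρ p.2 (a p.1))) * (adWord ρ s h₀ * g) := by
        ext1 a; simp [adWord, mul_assoc]
      rw [this, List.map_cons, ← Multiset.cons_coe, Multiset.cons_add]
      exact ad_mul_mem p.2 p.1 ih
  | zero => simp
  | add f g _ _ h1 h2 => rw [add_mul]; exact add_mem h1 h2
  | smul c f _ h1 => rw [smul_mul_assoc]; exact Submodule.smul_mem _ _ h1

theorem Realizable.mem_adWordSpan (hρ : IsGeneralizedAction ρ) (hf : Realizable ρ m f) :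
    f ∈ adWordSpan ρ m := by
  induction hf with
  | zero m => exact zero_mem _
  | add _ _ h1 h2 => exact add_mem h1 h2
  | smul c _ h => exact Submodule.smul_mem _ _ h
  | mul _ _ h1 h2 => exact mul_mem_adWordSpan hρ h1 h2
  | act h => exact Submodule.subset_span ⟨[], h, rfl, by ext1; simp [adWord]⟩
  | ad h i => exact Submodule.subset_span ⟨[(i, h)], 1, rfl, by ext1; simp [adWord]⟩

end

end Realizable

/-! ### Schur's lemma and the density theorem. -/

section Density

variable {F H L : Type*} [Field F] [Ring H] [Algebra F H] [LieRing L] [LieAlgebra F L]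
  {ρ : H →ₐ[F] End F L}

theorem IsHSimple.nontrivial (hs : IsHSimple ρ) : Nontrivial L := by
  by_contra h
  rw [not_nontrivial_iff_subsingleton] at h
  exact hs.1 ⟨fun _ _ => Subsingleton.elim _ _⟩

/-- An eigenspace of `φ` is a nonzero `H`-invariant ideal, hence everything. -/
theorem IsHSimple.isHCentral [IsAlgClosed F] [FiniteDimensional F L] (hs : IsHSimple ρ) :
    IsHCentral ρ := by
  intro φ hφ hφρ
  have := hs.nontrivial
  obtain ⟨c, hc⟩ := Module.End.exists_eigenvalue φ
  refine ⟨c, ?_⟩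
  let I : LieIdeal F L :=
    { End.eigenspace φ c with
      lie_mem := by
        intro x m hm
        have hm' : φ m = c • m := End.mem_eigenspace_iff.1 hm
        have h1 : φ ⁅x, m⁆ = ⁅x, φ m⁆ := LinearMap.congr_fun (hφ x) m
        refine End.mem_eigenspace_iff.2 ?_
        rw [h1, hm', lie_smul] }
  have hmem : ∀ m, m ∈ I ↔ φ m = c • m := fun m => End.mem_eigenspace_iff
  have hI := hs.2 I fun h a ha => by
    rw [hmem] at ha ⊢
    have h1 : φ (ρ h a) = ρ h (φ a) := LinearMap.congr_fun (hφρ h) a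
    rw [h1, ha, map_smul]
  rcases hI with hI | hI
  · obtain ⟨v, hv⟩ := hc.exists_hasEigenvector
    have : v ∈ I := hv.1
    rw [hI, LieSubmodule.mem_bot] at this
    exact absurd this hv.2
  · ext m
    have : m ∈ I := hI ▸ LieSubmodule.mem_top m
    simpa using (hmem m).1 this

/-- Submodules over the generated algebra are `H`-invariant ideals, so `L` is a simple module; its
endomorphisms are scalars by centrality. Jacobson density on a finite basis then reaches every
operator. -/
theorem adjoin_eq_top [FiniteDimensional F L] (hs : IsHSimple ρ) (hc : IsHCentral ρ) :
    Algebra.adjoin F (Set.range (LieAlgebra.ad F L) ∪ Set.range ρ) = ⊤ := by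
  set A := Algebra.adjoin F (Set.range (LieAlgebra.ad F L) ∪ Set.range ρ) with hA
  have had : ∀ x, LieAlgebra.ad F L x ∈ A := fun x => Algebra.subset_adjoin (Or.inl ⟨x, rfl⟩)
  have hact : ∀ h, ρ h ∈ A := fun h => Algebra.subset_adjoin (Or.inr ⟨h, rfl⟩)
  have := hs.nontrivial
  have hsimp : IsSimpleModule A L := by
    rw [isSimpleModule_iff]
    refine { eq_bot_or_eq_top := fun N => ?_ }
    let I : LieIdeal F L :=
      { N.toAddSubmonoid with
        smul_mem' := fun c m hm => by
          have := N.smul_mem (algebraMap F A c) hm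
          simpa using this
        lie_mem := fun {x m} hm => N.smul_mem ⟨_, had x⟩ hm }
    rcases hs.2 I fun h a ha => N.smul_mem ⟨_, hact h⟩ ha with h | h
    · left
      ext m
      have : m ∈ I ↔ m ∈ (⊥ : LieIdeal F L) := by rw [h]
      exact this.trans (by simp)
    · right
      ext m
      have : m ∈ I ↔ m ∈ (⊤ : LieIdeal F L) := by rw [h]
      exact this.trans (by simp)
  refine Algebra.eq_top_iff.2 fun f => ?_
  have hscal : ∀ φ : End A L, ∃ c : F, ∀ m, φ m = c • m := by
    intro φ
    have hsm : ∀ (r : A) m, φ ((r : End F L) m) = (r : End F L) (φ m) := fun r m => φ.map_smul r m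
    let φ' : End F L :=
      { φ with
        map_smul' := fun c m => by
          exact hsm (algebraMap F A c) m }
    obtain ⟨c, hc'⟩ := hc φ' (fun a => LinearMap.ext fun m => hsm ⟨_, had a⟩ m)
      (fun h => LinearMap.ext fun m => hsm ⟨_, hact h⟩ m)
    exact ⟨c, fun m => LinearMap.congr_fun hc' m⟩
  let f' : End (End A L) L :=
    { f with
      map_smul' := fun φ m => by
        obtain ⟨c, hφ⟩ := hscal φ
        simp [hφ] }
  classical
  obtain ⟨r, hr⟩ := jacobson_density f' (Finset.univ.image (Module.finBasis F L))
  have : f = r := (Module.finBasis F L).ext fun i => hr _ (by simp)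
  exact this ▸ r.2

/-- The values of realizable functions of finitely many variables, each of degree one. -/
def realizableValues (ρ : H →ₐ[F] End F L) : Set (End F L) :=
  {T | ∃ (N : ℕ) (f : (Fin N → L) → End F L) (w : Fin N → L),
    Realizable ρ Finset.univ.val f ∧ f w = T}

theorem map_univ_castAdd_add_natAdd (N M : ℕ) :
    (Finset.univ : Finset (Fin N)).val.map (Fin.castAdd M) +
      (Finset.univ : Finset (Fin M)).val.map (Fin.natAdd N) =
      (Finset.univ : Finset (Fin (N + M))).val := by
  refine (Multiset.Nodup.ext ?_ Finset.univ.nodup).2 fun x => ?_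
  · refine Multiset.nodup_add.2 ⟨Finset.univ.nodup.map (Fin.castAdd_injective N M),
      Finset.univ.nodup.map (Fin.natAdd_injective M N), ?_⟩
    rw [Multiset.disjoint_left]
    intro x hx hx'
    obtain ⟨i, _, rfl⟩ := Multiset.mem_map.1 hx
    obtain ⟨j, _, hj⟩ := Multiset.mem_map.1 hx'
    have := congrArg Fin.val hj
    rw [Fin.val_natAdd, Fin.val_castAdd] at this
    lia
  · refine ⟨fun _ => Finset.mem_univ x, fun _ => ?_⟩
    induction x using Fin.addCases <;> simp

theorem ad_mem_realizableValues (x : L) : LieAlgebra.ad F L x ∈ realizableValues ρ :=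
  ⟨1, fun a => LieAlgebra.ad F L (ρ 1 (a 0)), fun _ => x, Realizable.ad 1 0, by simp⟩

theorem span_realizableValues [FiniteDimensional F L] (hs : IsHSimple ρ) (hc : IsHCentral ρ) :
    Submodule.span F (realizableValues ρ) = ⊤ := by
  have h := congrArg Subalgebra.toSubmodule (adjoin_eq_top hs hc)
  rw [Algebra.adjoin_eq_span, Algebra.top_toSubmodule] at h
  refine top_le_iff.1 (h ▸ Submodule.span_mono fun T hT => ?_)
  induction hT using Submonoid.closure_induction with
  | mem T hT =>
    rcases hT with ⟨x, rfl⟩ | ⟨h, rfl⟩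
    · exact ad_mem_realizableValues x
    · exact ⟨0, fun _ => ρ h, Fin.elim0, Realizable.act h, rfl⟩
  | one => exact ⟨0, fun _ => 1, Fin.elim0, Realizable.one, rfl⟩
  | mul S T _ _ hS hT =>
    obtain ⟨N, f, w, hf, rfl⟩ := hS
    obtain ⟨M, g, w', hg, rfl⟩ := hT
    -- The two factors use disjoint variables, which keeps every degree equal to one.
    refine ⟨N + M, _, Fin.append w w', ((hf.rename (Fin.castAdd M)).mul
      (hg.rename (Fin.natAdd N))).congr (map_univ_castAdd_add_natAdd N M) fun a => rfl, ?_⟩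
    simp only [Pi.mul_apply]
    congr 2 <;> ext i <;> simp

end Density

/-! ### The first central function, with one alternating set. -/

section Base

variable {F H L : Type*} [Field F] [Ring H] [Algebra F H] [LieRing L] [LieAlgebra F L]
  {ρ : H →ₐ[F] End F L}

theorem map_univ_val_eq_sum {α β : Type*} [Fintype α] (g : α → β) :
    (Finset.univ : Finset α).val.map g = ∑ i, ({g i} : Multiset β) := by
  rw [← Finset.sum_multiset_singleton, ← Multiset.coe_mapAddMonoidHom, map_sum]
  simp

theorem Realizable.rotatedWord {ι : Type*} {n : ℕ} {X Y : Fin n → (ι → L) → End F L}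
    {W : (ι → L) → End F L} {M N : Fin n → Multiset ι} {m : Multiset ι}
    (hX : ∀ p, Realizable ρ (M p) (X p)) (hY : ∀ p, Realizable ρ (N p) (Y p))
    (hW : Realizable ρ m W) (p : Fin n) :
    Realizable ρ (∑ q, M q + ∑ q, N q + m)
      fun a => HLie.rotatedWord (fun q => X q a) (fun q => Y q a) (W a) p := by
  have hB := fun q => (hX q).mul (hY q)
  refine (((((hX p).mul hW).mul (hY p)).mul (list_prod ((List.finRange n).drop (p + 1)) hB)).mul
    (list_prod ((List.finRange n).take p) hB)).congr ?_ fun a => rfl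
  have h1 : (List.finRange n) =
      (List.finRange n).take p ++ p :: (List.finRange n).drop (p + 1) := by
    conv_lhs => rw [← List.take_append_drop p (List.finRange n)]
    congr 1
    rw [List.drop_eq_getElem_cons (by simp)]
    simp
  have h2 : ∑ q, M q + ∑ q, N q = ((List.finRange n).map fun q => M q + N q).sum := by
    rw [← Finset.sum_add_distrib, Fin.sum_univ_def]
  rw [h2]
  conv_rhs => rw [h1]
  simp only [List.map_append, List.map_cons, List.sum_append, List.sum_cons]
  abel

theorem Realizable.centralPoly {ι : Type*} {n : ℕ} {X Y : Fin n → (ι → L) → End F L}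
    {W : (ι → L) → End F L} {M N : Fin n → Multiset ι} {m : Multiset ι}
    (hX : ∀ p, Realizable ρ (M p) (X p)) (hY : ∀ p, Realizable ρ (N p) (Y p))
    (hW : Realizable ρ m W) :
    Realizable ρ (∑ q, M q + ∑ q, N q + m)
      fun a => HLie.centralPoly (fun q => X q a) (fun q => Y q a) (W a) := by
  refine Realizable.sum Finset.univ fun σ _ => Realizable.zsmul (Equiv.Perm.sign σ : ℤ)
    (Realizable.sum Finset.univ fun p _ => ?_)
  refine (Realizable.rotatedWord (fun q => hX (σ q)) hY hW p).congr ?_ fun a => rfl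
  rw [Equiv.sum_comp σ M]

theorem exists_alternating_sumElim {V E ι κ : Type*} [AddCommGroup V] [Module F V]
    [AddCommGroup E] [Module F E] (d : E [⋀^ι ⊕ κ]→ₗ[F] F) (φ : V →ₗ[F] E) (r : κ → E) :
    ∃ D : V [⋀^ι]→ₗ[F] F, ∀ z, D z = d (Sum.elim (φ ∘ z) r) := by
  classical
  have hup : ∀ (inst : DecidableEq ι) (z : ι → V) (i : ι) (x : V),
      Sum.elim (φ ∘ Function.update z i x) r =
        Function.update (Sum.elim (φ ∘ z) r) (Sum.inl i) (φ x) := by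
    intro inst z i x
    ext (j | j)
    · by_cases h : j = i
      · subst h; simp
      · simp [h]
    · simp
  refine ⟨⟨⟨fun z => d (Sum.elim (φ ∘ z) r), ?_, ?_⟩, ?_⟩, fun z => rfl⟩
  · intro inst z i x y
    simp only [hup, map_add, d.map_update_add]
  · intro inst z i c x
    simp only [hup, map_smul, d.map_update_smul]
  · intro z i j hij hne
    exact d.map_eq_zero_of_eq _ (i := Sum.inl i) (j := Sum.inl j) (by simp [hij])
      (by simpa using hne)

theorem exists_basis_extending_ad [FiniteDimensional F L] [LieAlgebra.IsKilling F L]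
    (hs : IsHSimple ρ) (hc : IsHCentral ρ) {t : ℕ} (l : Basis (Fin t) F L) :
    ∃ (k : ℕ) (X : Basis (Fin t ⊕ Fin k) F (End F L)),
      (∀ i, X (Sum.inl i) = LieAlgebra.ad F L (l i)) ∧
        ∀ j, X (Sum.inr j) ∈ realizableValues ρ := by
  classical
  have hinj : Function.Injective (LieAlgebra.ad F L) := by
    intro x y hxy
    refine sub_eq_zero.1
      ((LieAlgebra.IsKilling.killingForm_nondegenerate F L).1 (x - y) fun z => ?_)
    rw [killingForm_apply_apply, map_sub, hxy, sub_self, LinearMap.zero_comp, map_zero]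
  have hli : LinearIndependent F fun i => LieAlgebra.ad F L (l i) :=
    l.linearIndependent.map' (LieAlgebra.ad F L : L →ₗ[F] End F L) (LinearMap.ker_eq_bot.2 hinj)
  have hsub : Set.range (fun i => LieAlgebra.ad F L (l i)) ⊆ realizableValues ρ := by
    rintro _ ⟨i, rfl⟩
    exact ad_mem_realizableValues _
  have hli' := hli.linearIndepOn_id
  let b := Basis.extendLe hli' hsub (span_realizableValues hs hc).ge
  have hsub' := hli'.subset_extend hsub
  have hfin : Fintype (hli'.extend hsub) := FiniteDimensional.fintypeBasisIndex b
  let e₁ : Fin t ≃ {x : hli'.extend hsub // x.1 ∈ Set.range fun i => LieAlgebra.ad F L (l i)} :=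
    Equiv.ofBijective (fun i => ⟨⟨_, hsub' ⟨i, rfl⟩⟩, ⟨i, rfl⟩⟩) ⟨fun i j hij =>
      hli.injective (congrArg (fun x => x.1.1) hij), by
      rintro ⟨⟨x, hx⟩, ⟨i, hi⟩⟩
      exact ⟨i, Subtype.ext (Subtype.ext hi)⟩⟩
  let e₂ := (Fintype.equivFin
    {x : hli'.extend hsub // x.1 ∉ Set.range fun i => LieAlgebra.ad F L (l i)}).symm
  let e := (Equiv.sumCongr e₁ e₂).trans (Equiv.sumCompl _)
  refine ⟨_, b.reindex e.symm, fun i => ?_, fun j => ?_⟩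
  · simp only [Basis.reindex_apply, Equiv.symm_symm]
    rw [show b (e (Sum.inl i)) = ((e (Sum.inl i) : hli'.extend hsub) : End F L) by simp [b]]
    rfl
  · simp only [Basis.reindex_apply, Equiv.symm_symm]
    have : b (e (Sum.inr j)) = ((e (Sum.inr j) : hli'.extend hsub) : End F L) := by
      simp [b]
    rw [this]
    exact hli'.extend_subset hsub (e (Sum.inr j)).2

theorem exists_realizable_det_smul_one [FiniteDimensional F L] [LieAlgebra.IsKilling F L]
    (hs : IsHSimple ρ) (hc : IsHCentral ρ) {t : ℕ} (l : Basis (Fin t) F L) :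
    ∃ (N : ℕ) (w : Fin N → L) (θ : (Fin N → L) → F), θ w = 1 ∧
      Realizable ρ (Finset.univ : Finset (Fin t ⊕ Fin N)).val
        fun a => l.det (a ∘ Sum.inl) • θ (a ∘ Sum.inr) • 1 := by
  classical
  have := hs.nontrivial
  obtain ⟨k, X, hXl, hXr⟩ := exists_basis_extending_ad hs hc l
  let e : Fin (t + k) ≃ Fin t ⊕ Fin k := finSumFinEquiv.symm
  have hX : ∀ y, X y ∈ realizableValues ρ := by
    rintro (i | j)
    · rw [hXl]; exact ad_mem_realizableValues _
    · exact hXr j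
  obtain ⟨c, hc⟩ := exists_capelliForm_ne_zero (X.reindex e.symm)
  have hq : ∃ q, LinearMap.trace F L (X q) ≠ 0 := by
    by_contra! h
    have h0 : LinearMap.trace F L = 0 := X.ext fun q => by simpa using h q
    obtain ⟨i⟩ := l.index_nonempty
    have h1 := LinearMap.trace_smulRight (l.coord i) (l i)
    simp [h0] at h1
  obtain ⟨q, hq⟩ := hq
  choose N f w hf hfw using hX
  -- `J` lists the slots not occupied by `ad z_i`: the other `k` slots of `X`, all slots of `Y`, and
  -- `W`. Each slot receives its own copy of the variables in `R`, even where the same basis vector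
  -- is reused.
  let J := Fin k ⊕ (Fin (t + k) ⊕ Unit)
  let J' : J → Fin t ⊕ Fin k := Sum.elim Sum.inr (Sum.elim (fun p => e (c p)) fun _ => q)
  let R := Σ j : J, Fin (N (J' j))
  let deg : J → Multiset (Fin t ⊕ R) := fun j =>
    (Finset.univ : Finset (Fin (N (J' j)))).val.map fun x => Sum.inr ⟨j, x⟩
  let val : J → (R → L) → End F L := fun j r => f (J' j) fun x => r ⟨j, x⟩
  have hval : ∀ j, Realizable ρ (deg j) fun a => val j (a ∘ Sum.inr) := fun j =>
    ((hf (J' j)).rename fun x => (Sum.inr ⟨j, x⟩ : Fin t ⊕ R))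
  let M : Fin t ⊕ Fin k → Multiset (Fin t ⊕ R) :=
    Sum.elim (fun i => {Sum.inl i}) fun j => deg (Sum.inl j)
  let x : Fin t ⊕ Fin k → (Fin t ⊕ R → L) → End F L := fun y a =>
    Sum.elim (fun i => LieAlgebra.ad F L (a (Sum.inl i)))
      (fun j => val (Sum.inl j) (a ∘ Sum.inr)) y
  have hx : ∀ y, Realizable ρ (M y) (x y) := by
    rintro (i | j)
    · exact (Realizable.ad 1 (Sum.inl i)).congr rfl fun a => by simp [x]
    · exact hval (Sum.inl j)
  have hQ := Realizable.centralPoly (fun p => hx (e p))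
    (fun p => hval (Sum.inr (Sum.inl p))) (hval (Sum.inr (Sum.inr ())))
  let d : (R → L) → (Fin t → L) → F := fun r z =>
    capelliForm (fun p => val (Sum.inr (Sum.inl p)) r) fun p =>
      Sum.elim (LieAlgebra.ad F L ∘ z) (fun j => val (Sum.inl j) r) (e p)
  -- With the remaining slots frozen, the Capelli form is alternating in `t = dim L` vectors of `L`.
  have hd : ∀ r z, d r z = l.det z * d r l := by
    intro r z
    obtain ⟨D, hD⟩ := exists_alternating_sumElim
      ((capelliForm fun p => val (Sum.inr (Sum.inl p)) r).domDomCongr e)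
      (LieAlgebra.ad F L : L →ₗ[F] End F L) (fun j => val (Sum.inl j) r)
    have h1 : ∀ z, d r z = D z := fun z => by rw [hD]; rfl
    rw [h1, h1]
    conv_lhs => rw [D.eq_smul_basis_det l]
    simp [mul_comm]
  let θ : (R → L) → F := fun r =>
    LinearMap.trace F L (val (Sum.inr (Sum.inr ())) r) * d r l
  let w₀ : R → L := fun y => w (J' y.1) y.2
  have hvw : ∀ j, val j w₀ = X (J' j) := fun j => hfw (J' j)
  have hθ : θ w₀ ≠ 0 := by
    refine mul_ne_zero (by rw [hvw]; exact hq) ?_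
    have : d w₀ l = capelliForm (fun i => (X.reindex e.symm) (c i)) (X.reindex e.symm) := by
      simp only [d, hvw]
      have h1 : (fun p => Sum.elim (LieAlgebra.ad F L ∘ l) (fun j => X (J' (Sum.inl j))) (e p)) =
          X.reindex e.symm := by
        funext p
        rw [Basis.reindex_apply, Equiv.symm_symm]
        rcases e p with i | j
        · simp [hXl]
        · rfl
      rw [h1]
      congr 2
      funext p
      rw [Basis.reindex_apply, Equiv.symm_symm]
      rfl
    rw [this]
    exact hc
  have hdeg : ∑ p, M (e p) + ∑ p, deg (Sum.inr (Sum.inl p)) + deg (Sum.inr (Sum.inr ())) =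
      (Finset.univ : Finset (Fin t ⊕ R)).val := by
    have h1 : (Finset.univ : Finset R).val =
        ∑ j : J, (Finset.univ : Finset (Fin (N (J' j)))).val.map (Sigma.mk j) := rfl
    have h2 : (Finset.univ : Finset (Fin t ⊕ R)).val =
        (Finset.univ : Finset (Fin t)).val.map Sum.inl +
          (Finset.univ : Finset R).val.map Sum.inr := rfl
    have h3 : (Finset.univ : Finset R).val.map (Sum.inr (α := Fin t)) = ∑ j : J, deg j := by
      rw [h1, ← Multiset.coe_mapAddMonoidHom, map_sum]
      refine Finset.sum_congr rfl fun j _ => ?_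
      rw [Multiset.coe_mapAddMonoidHom, Multiset.map_map]
      rfl
    rw [h2, h3, map_univ_val_eq_sum, Equiv.sum_comp e M, Fintype.sum_sum_type, Fintype.sum_sum_type,
      Fintype.sum_sum_type]
    simp only [M, Sum.elim_inl, Sum.elim_inr, add_assoc, Finset.univ_unique, Finset.sum_singleton]
  have hbase : Realizable ρ (Finset.univ : Finset (Fin t ⊕ R)).val
      fun a => l.det (a ∘ Sum.inl) • ((θ w₀)⁻¹ * θ (a ∘ Sum.inr)) • 1 := by
    refine (hQ.smul (θ w₀)⁻¹).congr hdeg fun a => ?_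
    have hn : finrank F (End F L) = t + k := by
      rw [Module.finrank_eq_card_basis X]; simp
    rw [Pi.smul_apply, centralPoly_eq hn]
    have : (capelliForm fun q => val (Sum.inr (Sum.inl q)) (a ∘ Sum.inr))
        (fun q => x (e q) a) = d (a ∘ Sum.inr) (a ∘ Sum.inl) := rfl
    rw [this, hd, smul_smul, smul_smul]
    congr 1
    simp only [θ]
    ring
  let eR := Fintype.equivFin R
  refine ⟨Fintype.card R, w₀ ∘ eR.symm, fun r => (θ w₀)⁻¹ * θ (r ∘ eR), ?_,
    (hbase.rename (Equiv.sumCongr (Equiv.refl _) eR)).congr ?_ fun a => rfl⟩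
  · have : (w₀ ∘ eR.symm) ∘ eR = w₀ := by ext y; simp
    simp only [this, inv_mul_cancel₀ hθ]
  · have := Finset.univ_map_equiv_to_embedding (Equiv.sumCongr (Equiv.refl (Fin t)) eR)
    exact congrArg Finset.val this

end Base

/-! ### From operators to multilinear alternating `H`-polynomials. -/

section Polynomials

variable {F H L : Type*} [Field F] [Ring H] [Algebra F H] [LieRing L] [LieAlgebra F L]

theorem HPoly.eval_var {X : Type*} (ρ : H →ₐ[F] End F L) (a : X → L) (x : X) (h : H) :
    HPoly.eval ρ a (HPoly.var F x h) = ρ h (a x) := by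
  rw [HPoly.var, Finsupp.sum, map_sum]
  conv_rhs => rw [← (Basis.ofVectorSpace F H).linearCombination_repr h,
    Finsupp.linearCombination_apply, Finsupp.sum, map_sum, LinearMap.sum_apply]
  refine Finset.sum_congr rfl fun γ _ => ?_
  simp [HPoly.eval]

theorem HPoly.eval_rename {X Y : Type*} (ρ : H →ₐ[F] End F L) (a : Y → L) (s : X → Y)
    (f : HPoly F H X) :
    HPoly.eval ρ a (HPoly.rename s f) = HPoly.eval ρ (a ∘ s) f := by
  have : (HPoly.eval ρ a).comp (HPoly.rename (F := F) (H := H) s) = HPoly.eval ρ (a ∘ s) := by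
    ext p
    simp [HPoly.eval, HPoly.rename]
  exact LieHom.congr_fun this f

theorem HPoly.rename_rename {X Y Z : Type*} (s : X → Y) (r : Y → Z) (f : HPoly F H X) :
    HPoly.rename r (HPoly.rename s f) = HPoly.rename (r ∘ s) f := by
  have : (HPoly.rename (F := F) (H := H) r).comp (HPoly.rename s) = HPoly.rename (r ∘ s) := by
    ext p
    simp [HPoly.rename]
  exact LieHom.congr_fun this f

theorem HPoly.rename_var {X Y : Type*} (s : X → Y) (x : X) (h : H) :
    HPoly.rename s (HPoly.var F x h) = HPoly.var F (s x) h := by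
  rw [HPoly.var, HPoly.var, Finsupp.sum, Finsupp.sum, map_sum]
  refine Finset.sum_congr rfl fun γ _ => ?_
  simp [HPoly.rename]

theorem map_leftNormed {M N : Type*} [LieRing M] [LieAlgebra F M] [LieRing N] [LieAlgebra F N]
    (φ : M →ₗ⁅F⁆ N) (s : List M) : φ (leftNormed s) = leftNormed (s.map φ) := by
  cases s with
  | nil => simp [leftNormed]
  | cons x s =>
    simp only [leftNormed, List.map_cons]
    induction s generalizing x with
    | nil => simp
    | cons y s ih => simp [ih]

theorem HPoly.rename_mem_multilinear {X : Type*} [Fintype X] (σ : Equiv.Perm X) {f : HPoly F H X}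
    (hf : f ∈ HPoly.multilinear F H X) : HPoly.rename σ f ∈ HPoly.multilinear F H X := by
  induction hf using Submodule.span_induction with
  | mem f hf =>
    obtain ⟨e, h, rfl⟩ := hf
    refine Submodule.subset_span ⟨e.trans σ, h, ?_⟩
    rw [map_leftNormed, List.map_ofFn]
    congr 2
    ext1 i
    exact HPoly.rename_var _ _ _
  | zero => simp
  | add f g _ _ h1 h2 => rw [map_add]; exact add_mem h1 h2
  | smul c f _ h1 => rw [map_smul]; exact Submodule.smul_mem _ _ h1

theorem HPoly.leftNormed_mem_multilinear {X : Type*} [Fintype X] (s : List (X × H))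
    (hs : (s.map Prod.fst : Multiset X) = Finset.univ.val) :
    leftNormed (s.map fun p => HPoly.var F p.1 p.2) ∈ HPoly.multilinear F H X := by
  classical
  have hlen : s.length = Fintype.card X := by
    have := congrArg Multiset.card hs
    simpa using this
  have hnd : (s.map Prod.fst).Nodup := by
    rw [← Multiset.coe_nodup, hs]
    exact Finset.univ.nodup
  have hinj : Function.Injective fun i : Fin (Fintype.card X) => (s.get (i.cast hlen.symm)).1 := by
    intro i j hij
    have := List.nodup_iff_injective_get.1 hnd
      (a₁ := i.cast (by simp [hlen])) (a₂ := j.cast (by simp [hlen])) (by simpa using hij)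
    simpa [Fin.ext_iff] using this
  refine Submodule.subset_span ⟨Equiv.ofBijective _
    ((Fintype.bijective_iff_injective_and_card _).2 ⟨hinj, by simp⟩),
    fun i => (s.get (i.cast hlen.symm)).2, ?_⟩
  congr 1
  apply List.ext_getElem
  · simp [hlen]
  · intro i h1 h2
    simp

theorem foldl_lie_eq (s : List L) (v : L) :
    s.foldl (fun u x => ⁅u, x⁆) v =
      (-1 : ℤ) ^ s.length • (s.reverse.map (LieAlgebra.ad F L)).prod v := by
  induction s using List.reverseRecOn with
  | nil => simp
  | append_singleton s x ih =>
    rw [List.foldl_append]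
    simp only [List.foldl_cons, List.foldl_nil, ih, List.length_append, List.length_singleton,
      List.reverse_append, List.reverse_singleton, List.singleton_append, List.map_cons,
      List.prod_cons, Module.End.mul_apply, LieAlgebra.ad_apply, pow_succ, mul_neg, mul_one,
      neg_smul]
    rw [← lie_skew, lie_zsmul]

/-- Realizable functions of degree one in every variable come from multilinear `H`-polynomials
with one more variable. -/
theorem Realizable.exists_multilinear {ι : Type*} [Fintype ι] {ρ : H →ₐ[F] End F L}
    (hρ : IsGeneralizedAction ρ) {f : (ι → L) → End F L}
    {X : Type*} [Fintype X] (e : ι → X) (z : X)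
    (he : z ::ₘ (Finset.univ : Finset ι).val.map e = (Finset.univ : Finset X).val)
    (hf : Realizable ρ Finset.univ.val f) :
    ∃ p ∈ HPoly.multilinear F H X, ∀ a : X → L, HPoly.eval ρ a p = f (a ∘ e) (a z) := by
  have hf' := hf.mem_adWordSpan hρ
  clear hf
  induction hf' using Submodule.span_induction with
  | mem f hf =>
    obtain ⟨s, h₀, hs, rfl⟩ := hf
    -- The rightmost operator acts first, so the commutator starts with `z^{h₀}` and takes the
    -- letters in reverse; each right bracket is `-ad`, whence the sign.
    let s' : List (X × H) := s.reverse.map fun p => (e p.1, p.2)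
    refine ⟨((-1 : ℤ) ^ s.length) • leftNormed (((z, h₀) :: s').map fun p => HPoly.var F p.1 p.2),
      ?_, fun a => ?_⟩
    · refine zsmul_mem (HPoly.leftNormed_mem_multilinear _ ?_) _
      rw [← he, List.map_cons, ← Multiset.cons_coe, ← hs]
      congr 1
      simp [s', List.map_reverse, Multiset.coe_reverse, Function.comp_def]
    · rw [map_zsmul, map_leftNormed]
      simp only [List.map_map, List.map_cons, leftNormed, HPoly.eval_var]
      rw [foldl_lie_eq (F := F), smul_smul]
      simp [s', adWord, List.map_reverse, Function.comp_def, HPoly.eval_var, ← mul_pow]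
  | zero => exact ⟨0, zero_mem _, fun a => by simp⟩
  | add f g _ _ h1 h2 =>
    obtain ⟨p, hp, hp'⟩ := h1
    obtain ⟨q, hq, hq'⟩ := h2
    exact ⟨p + q, add_mem hp hq, fun a => by simp [hp', hq']⟩
  | smul c f _ h1 =>
    obtain ⟨p, hp, hp'⟩ := h1
    refine ⟨c • p, Submodule.smul_mem _ _ hp, fun a => ?_⟩
    simp only [map_smul, hp', Pi.smul_apply, LinearMap.smul_apply]

/-- Antisymmetrization: a multilinear `H`-polynomial whose values are alternating in some sets of
variables has the same values as one that is itself alternating in these sets. -/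
theorem HPoly.exists_alternating [CharZero F] {X : Type*} [Fintype X] [DecidableEq X]
    (ρ : H →ₐ[F] End F L) {p : HPoly F H X} (hp : p ∈ HPoly.multilinear F H X)
    (B : Set (Set X))
    (halt : ∀ S ∈ B, ∀ σ : Equiv.Perm X, (∀ x, x ∉ S → σ x = x) → ∀ a : X → L,
      HPoly.eval ρ (a ∘ σ) p = ((Equiv.Perm.sign σ : ℤ) : F) • HPoly.eval ρ a p) :
    ∃ q ∈ HPoly.multilinear F H X, (∀ S ∈ B, q.IsAlternatingIn S) ∧
      ∀ a : X → L, HPoly.eval ρ a q = HPoly.eval ρ a p := by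
  classical
  -- The sign rule for values extends from block permutations to the group they generate. The signed
  -- average over this group is alternating as a polynomial and has unchanged values.
  let G : Subgroup (Equiv.Perm X) :=
    Subgroup.closure {σ | ∃ S ∈ B, ∀ x, x ∉ S → σ x = x}
  have hsq : ∀ σ : Equiv.Perm X,
      ((Equiv.Perm.sign σ : ℤ) : F) * ((Equiv.Perm.sign σ : ℤ) : F) = 1 := by
    intro σ
    rw [← Int.cast_mul, ← Units.val_mul, ← sq, Int.units_sq]
    simp
  have hG : ∀ σ ∈ G, ∀ a : X → L,
      HPoly.eval ρ (a ∘ σ) p = ((Equiv.Perm.sign σ : ℤ) : F) • HPoly.eval ρ a p := by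
    intro σ hσ
    induction hσ using Subgroup.closure_induction with
    | mem σ hσ =>
      obtain ⟨S, hS, h⟩ := hσ
      exact halt S hS σ h
    | one => intro a; simp
    | mul σ τ _ _ h1 h2 =>
      intro a
      have : a ∘ (σ * τ : Equiv.Perm X) = (a ∘ σ) ∘ τ := rfl
      rw [this, h2, h1, smul_smul, Equiv.Perm.sign_mul, Units.val_mul, Int.cast_mul, mul_comm]
    | inv σ _ h =>
      intro a
      have h1 := h (a ∘ (σ⁻¹ : Equiv.Perm X))
      have h2 : (a ∘ (σ⁻¹ : Equiv.Perm X)) ∘ σ = a := by ext x; simp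
      rw [h2] at h1
      rw [h1, smul_smul, Equiv.Perm.sign_inv, hsq, one_smul]
  have hcard : (Fintype.card G : F) ≠ 0 := by
    simp
  refine ⟨(Fintype.card G : F)⁻¹ • ∑ σ : G, ((Equiv.Perm.sign (σ : Equiv.Perm X) : ℤ) : F) •
    HPoly.rename (σ : Equiv.Perm X) p, ?_, ?_, ?_⟩
  · exact Submodule.smul_mem _ _ (Submodule.sum_mem _ fun σ _ =>
      Submodule.smul_mem _ _ (HPoly.rename_mem_multilinear _ hp))
  · intro S hS τ hτ
    let τ' : G := ⟨τ, Subgroup.subset_closure ⟨S, hS, hτ⟩⟩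
    rw [map_smul, map_sum, smul_comm]
    congr 1
    rw [Finset.smul_sum]
    conv_rhs => rw [← Equiv.sum_comp (Equiv.mulLeft τ')]
    refine Finset.sum_congr rfl fun σ _ => ?_
    rw [map_smul, HPoly.rename_rename, smul_smul]
    have h1 : ((Equiv.mulLeft τ' σ : G) : Equiv.Perm X) = τ * σ := rfl
    rw [h1, Equiv.Perm.sign_mul, Units.val_mul, Int.cast_mul, ← mul_assoc, hsq, one_mul]
    rfl
  · intro a
    rw [map_smul, map_sum]
    have : ∀ σ : G, HPoly.eval ρ a (((Equiv.Perm.sign (σ : Equiv.Perm X) : ℤ) : F) •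
        HPoly.rename (σ : Equiv.Perm X) p) = HPoly.eval ρ a p := by
      intro σ
      rw [map_smul, HPoly.eval_rename, hG _ σ.2, smul_smul, hsq, one_smul]
    simp only [this, Finset.sum_const, Finset.card_univ]
    rw [← Nat.cast_smul_eq_nsmul F, smul_smul, inv_mul_cancel₀ hcard, one_smul]

end Polynomials

/-! ### New alternating sets from the Killing form. -/

section Killing

variable {F H L : Type*} [Field F] [Ring H] [Algebra F H] [LieRing L] [LieAlgebra F L]
  {ρ : H →ₐ[F] End F L}

theorem det_killingForm {t : ℕ} (l : Basis (Fin t) F L) (u v : Fin t → L) :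
    (Matrix.of fun i j => killingForm F L (u i) (v j)).det =
      (Matrix.of fun i j => killingForm F L (l i) (l j)).det * (l.det u * l.det v) := by
  have : (Matrix.of fun i j => killingForm F L (u i) (v j)) =
      (l.toMatrix u).transpose * (Matrix.of fun i j => killingForm F L (l i) (l j)) *
        l.toMatrix v := by
    ext i j
    simp only [Matrix.of_apply, Matrix.mul_apply, Matrix.transpose_apply, Basis.toMatrix_apply]
    conv_lhs => rw [← l.sum_repr (u i), ← l.sum_repr (v j)]
    simp only [map_sum, map_smul, LinearMap.sum_apply, LinearMap.smul_apply, smul_eq_mul,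
      Finset.sum_mul, Finset.mul_sum]
    refine Finset.sum_congr rfl fun p _ => Finset.sum_congr rfl fun q _ => ?_
    ring
  rw [this, Matrix.det_mul, Matrix.det_mul, Matrix.det_transpose, ← Basis.det_apply,
    ← Basis.det_apply]
  ring

theorem det_killingForm_basis_ne_zero [FiniteDimensional F L] [LieAlgebra.IsKilling F L] {t : ℕ}
    (l : Basis (Fin t) F L) : (Matrix.of fun i j => killingForm F L (l i) (l j)).det ≠ 0 := by
  have h := (LinearMap.BilinForm.nondegenerate_iff_det_ne_zero (B := killingForm F L) l).1
    (LieAlgebra.IsKilling.killingForm_nondegenerate F L)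
  convert h
  ext i j
  simp

namespace Realizable

variable {ι : Type*} {m : Multiset ι} {t : ℕ} {z : Fin t → ι} {g : (ι → L) → End F L}

/-- Replacing `a_{zᵢ}` by `[a_u, [a_v, a_{zᵢ}]]` and summing over `i` multiplies a function which
is a top-degree alternating form in the variables `zᵢ` by the Killing form of `a_u` and `a_v`. -/
theorem killing_smul (hρ : IsGeneralizedAction ρ) [DecidableEq ι] (l : Basis (Fin t) F L)
    (hz : Function.Injective z) (hm : ∀ i, m.count (z i) = 1)
    (hg : ∀ a i y, g (Function.update a (z i) y) = g a)
    (hf : Realizable ρ m fun a => l.det (a ∘ z) • g a) (u v : ι) :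
    Realizable ρ (m + ({u} + {v})) fun a =>
      l.det (a ∘ z) • killingForm F L (a u) (a v) • g a := by
  have key : ∀ i, Realizable ρ (m + ({u} + {v})) fun a =>
      l.det (Function.update (a ∘ z) i ⁅a u, ⁅a v, a (z i)⁆⁆) • g a := by
    intro i
    have hb : ∀ (x : ι) (h : H), Realizable ρ
        (if x = z i then {u} + ({v} + {z i}) else {x}) fun a =>
          LieAlgebra.ad F L (ρ h (Function.update a (z i) ⁅a u, ⁅a v, a (z i)⁆⁆ x)) := by
      intro x h
      by_cases hx : x = z i
      · subst hx
        simp only [if_true, Function.update_self]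
        exact ad_lie hρ (fun h => ad h u) (fun h => ad_lie hρ (fun h => ad h v)
          (fun h => ad h (z i)) h) h
      · simp only [hx, if_false]
        exact (ad h x).congr rfl fun a => by simp [hx]
    refine (hf.bind hb).congr ?_ fun a => ?_
    -- Since `z i` occurs exactly once, the substitution adds exactly one `u` and one `v` to the
    -- degree.
    · obtain ⟨m', rfl⟩ := Multiset.exists_cons_of_mem
        (Multiset.count_pos.1 (by rw [hm i]; exact one_pos))
      have hm' : z i ∉ m' := by
        have := hm i
        rw [Multiset.count_cons_self] at this
        exact Multiset.count_eq_zero.1 (by lia)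
      rw [Multiset.cons_bind, if_pos rfl]
      have : (m'.bind fun x => if x = z i then {u} + ({v} + {z i}) else {x}) =
          m'.bind fun x => {x} :=
        Multiset.bind_congr fun x hx => if_neg fun h : x = z i => hm' (h ▸ hx)
      rw [this, Multiset.bind_singleton, Multiset.map_id', ← Multiset.singleton_add]
      abel
    · change l.det (Function.update a (z i) ⁅a u, ⁅a v, a (z i)⁆⁆ ∘ z) •
        g (Function.update a (z i) ⁅a u, ⁅a v, a (z i)⁆⁆) = _
      rw [hg, Function.update_comp_eq_of_injective _ hz]
  refine (sum Finset.univ fun i _ => key i).congr rfl fun a => ?_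
  rw [← Finset.sum_smul]
  have := sum_alternating_update l l.det (LieAlgebra.ad F L (a u) ∘ₗ LieAlgebra.ad F L (a v))
    (a ∘ z)
  simp only [LinearMap.comp_apply, LieAlgebra.ad_apply, Function.comp_apply] at this
  rw [this, smul_smul, ← killingForm_apply_apply, mul_comm]

/-- Since `u` and `v` avoid the `z i`, each new factor can be absorbed into `g` and the step
repeated. -/
theorem prod_killing_smul (hρ : IsGeneralizedAction ρ) [DecidableEq ι] (l : Basis (Fin t) F L)
    (hz : Function.Injective z) (hm : ∀ i, m.count (z i) = 1)
    (hg : ∀ a i y, g (Function.update a (z i) y) = g a)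
    (hf : Realizable ρ m fun a => l.det (a ∘ z) • g a) {α : Type*} (s : Finset α) (u v : α → ι)
    (hu : ∀ i j, u j ≠ z i) (hv : ∀ i j, v j ≠ z i) :
    Realizable ρ (m + ∑ j ∈ s, ({u j} + {v j})) fun a =>
      l.det (a ∘ z) • (∏ j ∈ s, killingForm F L (a (u j)) (a (v j))) • g a := by
  classical
  induction s using Finset.induction_on with
  | empty => exact hf.congr (by simp) (by simp)
  | insert x s hx ih =>
    refine (killing_smul hρ l hz (m := m + ∑ j ∈ s, ({u j} + {v j}))
      (g := fun a => (∏ j ∈ s, killingForm F L (a (u j)) (a (v j))) • g a) ?_ ?_ ih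
      (u x) (v x)).congr ?_ fun a => ?_
    · intro i
      rw [Multiset.count_add, hm, Multiset.count_sum', add_eq_left]
      refine Finset.sum_eq_zero fun j _ => ?_
      simp [(hu i j).symm, (hv i j).symm]
    · intro a i y
      simp only [hg, Function.update_of_ne (hu _ _), Function.update_of_ne (hv _ _)]
    · rw [Finset.sum_insert hx, add_assoc, add_comm (∑ j ∈ s, _)]
    · rw [Finset.prod_insert hx, smul_smul (killingForm F L _ _)]

/-- Expand `det κ(u_i,v_j)` over permutations and divide by the Gram determinant of `l`, nonzero by
nondegeneracy. -/
theorem det_smul_det_smul [FiniteDimensional F L] [LieAlgebra.IsKilling F L]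
    (hρ : IsGeneralizedAction ρ) [DecidableEq ι] (l : Basis (Fin t) F L)
    (hz : Function.Injective z) (hm : ∀ i, m.count (z i) = 1)
    (hg : ∀ a i y, g (Function.update a (z i) y) = g a)
    (hf : Realizable ρ m fun a => l.det (a ∘ z) • g a) (u v : Fin t → ι)
    (hu : ∀ i j, u j ≠ z i) (hv : ∀ i j, v j ≠ z i) :
    Realizable ρ (m + (∑ j, {u j} + ∑ j, {v j})) fun a =>
      l.det (a ∘ z) • (l.det (a ∘ u) * l.det (a ∘ v)) • g a := by
  have h1 : Realizable ρ (m + (∑ j, {u j} + ∑ j, {v j})) fun a =>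
      ∑ σ : Equiv.Perm (Fin t), (Equiv.Perm.sign σ : ℤ) •
        (l.det (a ∘ z) • (∏ j, killingForm F L (a (u (σ j))) (a (v j))) • g a) := by
    refine sum Finset.univ fun σ _ => zsmul _ ?_
    refine (prod_killing_smul hρ l hz hm hg hf Finset.univ (u ∘ σ) v (fun i j => hu i (σ j))
      hv).congr ?_ fun a => rfl
    rw [Finset.sum_add_distrib]
    congr 2
    exact Equiv.sum_comp (M := Multiset ι) σ fun j => {u j}
  refine (h1.smul (Matrix.of fun i j => killingForm F L (l i) (l j)).det⁻¹).congr rfl fun a => ?_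
  have h2 := det_killingForm l (a ∘ u) (a ∘ v)
  rw [Matrix.det_apply] at h2
  have h3 : l.det (a ∘ u) * l.det (a ∘ v) =
      (Matrix.of fun i j => killingForm F L (l i) (l j)).det⁻¹ *
        ∑ σ : Equiv.Perm (Fin t), Equiv.Perm.sign σ •
          ∏ j, killingForm F L (a (u (σ j))) (a (v j)) := by
    rw [eq_inv_mul_iff_mul_eq₀ (det_killingForm_basis_ne_zero l)]
    exact h2.symm
  rw [h3, Pi.smul_apply, smul_smul (l.det (a ∘ z)), mul_left_comm, mul_smul, Finset.mul_sum,
    Finset.sum_smul]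
  congr 1
  refine Finset.sum_congr rfl fun σ _ => ?_
  rw [Units.smul_def, mul_smul_comm, smul_assoc, mul_smul]

theorem prod_det_smul [FiniteDimensional F L] [LieAlgebra.IsKilling F L]
    (hρ : IsGeneralizedAction ρ) [DecidableEq ι] (l : Basis (Fin t) F L)
    (hz : Function.Injective z) (hm : ∀ i, m.count (z i) = 1)
    (hg : ∀ a i y, g (Function.update a (z i) y) = g a)
    (hf : Realizable ρ m fun a => l.det (a ∘ z) • g a) (u : ℕ → Fin t → ι)
    (k : ℕ) (hu : ∀ n < 2 * k, ∀ i j, u n j ≠ z i) :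
    Realizable ρ (m + ∑ n ∈ Finset.range (2 * k), ∑ j, {u n j}) fun a =>
      l.det (a ∘ z) • (∏ n ∈ Finset.range (2 * k), l.det (a ∘ u n)) • g a := by
  induction k with
  | zero => exact hf.congr (by simp) (by simp)
  | succ k ih =>
    have hu' : ∀ n < 2 * k, ∀ i j, u n j ≠ z i := fun n hn => hu n (by lia)
    refine (det_smul_det_smul hρ l hz
      (g := fun a => (∏ n ∈ Finset.range (2 * k), l.det (a ∘ u n)) • g a) ?_ ?_
      (ih hu') (u (2 * k)) (u (2 * k + 1)) (hu _ (by lia)) (hu _ (by lia))).congr ?_ fun a => ?_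
    · intro i
      rw [Multiset.count_add, hm, Multiset.count_sum', add_eq_left]
      refine Finset.sum_eq_zero fun n hn => ?_
      rw [Multiset.count_sum']
      refine Finset.sum_eq_zero fun j _ => ?_
      simp [(hu' n (Finset.mem_range.1 hn) i j).symm]
    · intro a i y
      have : ∀ n ∈ Finset.range (2 * k), l.det (Function.update a (z i) y ∘ u n) =
          l.det (a ∘ u n) := fun n hn => by
        congr 1
        ext j
        simp [Function.update_of_ne (hu' n (Finset.mem_range.1 hn) i j)]
      simp only [hg, Finset.prod_congr rfl this]
    · rw [show 2 * (k + 1) = 2 * k + 1 + 1 by ring, Finset.sum_range_succ, Finset.sum_range_succ]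
      simp only [add_assoc]
    · rw [show 2 * (k + 1) = 2 * k + 1 + 1 by ring, Finset.prod_range_succ,
        Finset.prod_range_succ]
      simp only [smul_smul]
      congr 1
      ring

end Realizable

end Killing

/-! ### Assembly of the polynomials. -/

section Main

theorem exists_perm_of_fixes_off_range {X : Type*} [Fintype X] [DecidableEq X] {t : ℕ}
    (u : Fin t ↪ X) (σ : Equiv.Perm X) (hσ : ∀ x, x ∉ Set.range u → σ x = x) :
    ∃ τ : Equiv.Perm (Fin t), (∀ i, σ (u i) = u (τ i)) ∧ Equiv.Perm.sign τ = Equiv.Perm.sign σ := by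
  classical
  have hmem : ∀ x, σ x ∈ Set.range u ↔ x ∈ Set.range u := by
    intro x
    refine ⟨fun h => ?_, fun h => ?_⟩ <;> by_contra hx
    · rw [hσ x hx] at h; exact hx h
    · have := σ.injective (hσ _ hx)
      rw [this] at hx
      exact hx h
  let e : Fin t ≃ Set.range u := Equiv.ofInjective u u.injective
  let σ' : Equiv.Perm (Set.range u) := σ.subtypePerm hmem
  refine ⟨e.symm.permCongr σ', fun i => ?_, ?_⟩
  · have : u (e.symm (σ' (e i))) = (σ' (e i) : X) :=
      congrArg Subtype.val (e.apply_symm_apply (σ' (e i)))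
    simp only [Equiv.permCongr_apply, Equiv.symm_symm]
    rw [this]
    rfl
  · rw [Equiv.Perm.sign_permCongr]
    convert Equiv.Perm.sign_subtypePerm σ hmem fun x hx => by
      by_contra h
      exact hx (hσ x h)

variable {F H L : Type*} [Field F] [Ring H] [Algebra F H] [LieRing L]
  [LieAlgebra F L] [FiniteDimensional F L] [LieAlgebra.IsKilling F L] {ρ : H →ₐ[F] End F L}

/-- The polynomials of the main theorem, as realizable functions of the variables `x_i^j` and
`z_1, …, z_C`. -/
theorem exists_realizable_prod_det_smul_one (hρ : IsGeneralizedAction ρ) (hs : IsHSimple ρ)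
    (hc : IsHCentral ρ) {t : ℕ} (l : Basis (Fin t) F L) :
    ∃ (C : ℕ) (w : Fin C → L) (θ : (Fin C → L) → F), 0 < C ∧ θ w = 1 ∧ ∀ k : ℕ,
      Realizable ρ (Finset.univ : Finset ((Fin (2 * k) × Fin t) ⊕ Fin C)).val fun a =>
        ((∏ j, l.det fun i => a (Sum.inl (j, i))) * θ (a ∘ Sum.inr)) • 1 := by
  classical
  have := hs.nontrivial
  obtain ⟨N, w, θ, hθ, hf⟩ := exists_realizable_det_smul_one hs hc l
  have ht : 0 < t := Fin.pos_iff_nonempty.2 l.index_nonempty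
  let e : Fin t ⊕ Fin N ≃ Fin (t + N) := finSumFinEquiv
  -- The alternating set `z` joins the auxiliary variables and is evaluated at `l`, where its
  -- determinant is `1`.
  refine ⟨t + N, Sum.elim l w ∘ e.symm,
    fun b => l.det (b ∘ e ∘ Sum.inl) * θ (b ∘ e ∘ Sum.inr), by lia, ?_, fun k => ?_⟩
  · have h1 : (Sum.elim l w ∘ e.symm) ∘ e ∘ Sum.inl = l := by ext i; simp
    have h2 : (Sum.elim l w ∘ e.symm) ∘ e ∘ Sum.inr = w := by ext i; simp
    simp only [h1, h2, hθ, Basis.det_self, mul_one]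
  · let ι := (Fin (2 * k) × Fin t) ⊕ Fin (t + N)
    let z : Fin t → ι := fun i => Sum.inr (e (Sum.inl i))
    let u : ℕ → Fin t → ι := fun n i => if h : n < 2 * k then Sum.inl (⟨n, h⟩, i) else z i
    have hz : Function.Injective z := fun i j hij =>
      Sum.inl_injective (e.injective (Sum.inr_injective hij))
    have hf' := hf.rename fun x => (Sum.inr (e x) : ι)
    have hm : ∀ i, ((Finset.univ : Finset (Fin t ⊕ Fin N)).val.map
        fun x => (Sum.inr (e x) : ι)).count (z i) = 1 := by
      intro i
      refine Multiset.count_eq_one_of_mem (Finset.univ.nodup.map ?_) ?_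
      · exact Sum.inr_injective.comp e.injective
      · exact Multiset.mem_map.2 ⟨Sum.inl i, Finset.mem_univ_val (Sum.inl i), rfl⟩
    refine (Realizable.prod_det_smul hρ l hz hm
      (g := fun a => θ (fun i => a (Sum.inr (e (Sum.inr i)))) • 1) ?_ hf' u k ?_).congr ?_ ?_
    · intro a i y
      congr 2
      ext j
      refine Function.update_of_ne ?_ _ _
      simp [z]
    · intro n hn i j
      simp [u, z, hn]
    · have h1 : (Finset.univ : Finset ι).val =
          (Finset.univ : Finset (Fin (2 * k) × Fin t)).val.map Sum.inl +
            (Finset.univ : Finset (Fin (t + N))).val.map Sum.inr := rfl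
      rw [h1]
      refine (add_comm _ _).trans (congrArg₂ _ ?_ ?_)
      · rw [map_univ_val_eq_sum, Fintype.sum_prod_type, Finset.sum_range]
        refine Finset.sum_congr rfl fun n _ => Finset.sum_congr rfl fun i _ => ?_
        simp [u]
      · rw [map_univ_val_eq_sum, map_univ_val_eq_sum]
        exact Equiv.sum_comp (M := Multiset ι) e fun x => {Sum.inr x}
    · intro a
      have h1 : ∏ n ∈ Finset.range (2 * k), l.det (a ∘ u n) =
          ∏ j, l.det fun i => a (Sum.inl (j, i)) := by
        rw [Finset.prod_range]
        refine Finset.prod_congr rfl fun n _ => ?_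
        congr 1
        ext i
        simp [u]
      rw [h1, smul_smul, smul_smul]
      congr 1
      have h2 : (a ∘ Sum.inr) ∘ e ∘ Sum.inl = a ∘ z := rfl
      have h3 : (a ∘ Sum.inr) ∘ e ∘ Sum.inr = fun i => a (Sum.inr (e (Sum.inr i))) := rfl
      simp only [h2, h3]
      ring

end Main

end HLie

theorem mainTheorem5 {F H L : Type*} [Field F] [CharZero F]
    [Ring H] [Algebra F H] [FiniteDimensional F H]
    [LieRing L] [LieAlgebra F L] [FiniteDimensional F L] [LieAlgebra.IsSemisimple F L]
    (ρ : H →ₐ[F] Module.End F L) (hρ : HLie.IsGeneralizedAction ρ)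
    (hsimple : HLie.IsHSimple ρ)
    (hcentral : IsAlgClosed F ∨ HLie.IsHCentral ρ)
    {t : ℕ} (l : Module.Basis (Fin t) F L) :
    ∃ (C : ℕ) (w : Fin C → L), 0 < C ∧
      ∀ k : ℕ, ∃ f : HLie.HPoly F H (HLie.Var t (2 * k) C),
        f ∈ HLie.HPoly.multilinear F H (HLie.Var t (2 * k) C) ∧
        (∀ j : Fin (2 * k), f.IsAlternatingIn (HLie.Var.block j)) ∧
        ∀ v : L, HLie.HPoly.eval ρ (HLie.Var.subst l w v) f = v := by
  classical
  have hc : HLie.IsHCentral ρ := hcentral.elim (fun _ => hsimple.isHCentral) id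
  -- In characteristic `0` semisimplicity supplies the required `IsKilling` instance.
  obtain ⟨C, w, θ, hC, hθ, hR⟩ := HLie.exists_realizable_prod_det_smul_one hρ hsimple hc l
  refine ⟨C, w, hC, fun k => ?_⟩
  let e : (Fin (2 * k) × Fin t) ⊕ Fin C → HLie.Var t (2 * k) C :=
    Sum.elim Sum.inl (Sum.inr ∘ Sum.inl)
  obtain ⟨p, hp, hpe⟩ := (hR k).exists_multilinear hρ e (Sum.inr (Sum.inr ())) (by
    refine (Multiset.Nodup.ext ?_ Finset.univ.nodup).2 fun x => ?_
    · refine Multiset.nodup_cons.2 ⟨fun h => ?_, Finset.univ.nodup.map ?_⟩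
      · obtain ⟨x | x, _, hx⟩ := Multiset.mem_map.1 h <;> simp [e] at hx
      · rintro (x | x) (y | y) hxy <;> simp [e] at hxy <;> simp [hxy]
    · refine ⟨fun _ => Finset.mem_univ x, fun _ => ?_⟩
      rcases x with x | x | x
      · exact Multiset.mem_cons_of_mem
          (Multiset.mem_map.2 ⟨Sum.inl x, Finset.mem_univ (Sum.inl x), rfl⟩)
      · exact Multiset.mem_cons_of_mem
          (Multiset.mem_map.2 ⟨Sum.inr x, Finset.mem_univ (Sum.inr x), rfl⟩)
      · exact Multiset.mem_cons_self _ _)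
  obtain ⟨q, hq, hqa, hqe⟩ := HLie.HPoly.exists_alternating ρ hp
    (Set.range (HLie.Var.block (t := t) (m := 2 * k) (C := C))) (by
      rintro _ ⟨j, rfl⟩ σ hσ a
      obtain ⟨τ, hτ, hsign⟩ := HLie.exists_perm_of_fixes_off_range
        ⟨fun i : Fin t => (Sum.inl (j, i) : HLie.Var t (2 * k) C),
          fun i i' h => by simpa using h⟩ σ hσ
      have hfix : ∀ x : Fin C ⊕ Unit, σ (Sum.inr x) = Sum.inr x := fun x =>
        hσ _ (by simp [HLie.Var.block])
      have hfix' : ∀ j', j' ≠ j → ∀ i, σ (Sum.inl (j', i)) = Sum.inl (j', i) := fun j' hj i =>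
        hσ _ (by simp [HLie.Var.block, hj.symm])
      rw [hpe, hpe]
      -- A permutation of block `j` changes only the `j`-th determinant, by its sign.
      have h1 : ∀ j', (l.det fun i => ((a ∘ σ) ∘ e) (Sum.inl (j', i))) =
          (if j' = j then ((Equiv.Perm.sign σ : ℤ) : F) else 1) *
            l.det fun i => (a ∘ e) (Sum.inl (j', i)) := by
        intro j'
        by_cases hj : j' = j
        · subst hj
          have h2 : (fun i => ((a ∘ σ) ∘ e) (Sum.inl (j', i))) =
              (fun i => (a ∘ e) (Sum.inl (j', i))) ∘ τ := funext fun i => congrArg a (hτ i)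
          rw [h2, AlternatingMap.map_perm, if_pos rfl, hsign, Units.smul_def, zsmul_eq_mul]
        · have h2 : (fun i => ((a ∘ σ) ∘ e) (Sum.inl (j', i))) =
              fun i => (a ∘ e) (Sum.inl (j', i)) := funext fun i => congrArg a (hfix' j' hj i)
          rw [h2, if_neg hj, one_mul]
      have h3 : ((a ∘ σ) ∘ e) ∘ Sum.inr = (a ∘ e) ∘ Sum.inr :=
        funext fun i => congrArg a (hfix (Sum.inl i))
      have h4 : (a ∘ σ) (Sum.inr (Sum.inr ())) = a (Sum.inr (Sum.inr ())) :=
        congrArg a (hfix (Sum.inr ()))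
      simp only [h1, h3, h4, Finset.prod_mul_distrib, Finset.prod_ite_eq', Finset.mem_univ, if_true,
        mul_assoc, mul_smul (((Equiv.Perm.sign σ : ℤ) : F))]
      rfl)
  refine ⟨q, hq, fun j => hqa _ ⟨j, rfl⟩, fun v => ?_⟩
  rw [hqe, hpe]
  have h1 : ∀ j, (fun i => (HLie.Var.subst l w v ∘ e) (Sum.inl (j, i))) = l := fun j => rfl
  have h2 : (HLie.Var.subst l w v ∘ e) ∘ Sum.inr = w := rfl
  simp only [h1, h2, hθ, Module.Basis.det_self, Finset.prod_const_one, mul_one, one_smul]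
  rfl
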